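/- **Setting.** For every $n$ let $Y_n = X_n\beta_n^0+\varepsilon_n$, where $X_n$ is a deterministic $n\times p_n$ matrix with $p_n\ge 1$, $\beta_n^0\in\mathbb R^{p_n}$ is the true coefficient vector, $q_n=|\{j:\beta^0_{nj}\ne 0\}|$, and $d_1\ge\dots\ge d_{p_n}\ge 0$ (depending on $n$) are the eigenvalues of $X_n^TX_n/n$. Assume * (A1) the errors $\varepsilon_{n1},\dots,\varepsilon_{nn}$ are i.i.d. with mean zero and finite variance $\sigma^2>0$ (the same $\sigma^2$ for all $n$); * (A2) $0<d_{\min}<\liminf_{n\to\infty} d_{p_n}\le\limsup_{n\to\infty} d_1<d_{\max}<\infty$ for fixed $d_{\min},d_{\max}$; * (A3) $\limsup_{n\to\infty}\max_{1\le j\le p_n}|\beta^0_{nj}|<\infty$. For $a>0$, the Dirichlet–Laplace prior on $\beta\in\mathbb R^p$ (with the error variance $\sigma^2$ given) is the marginal law of $\beta$ in the hierarchy $$(\phi_1,\dots,\phi_p)\sim\mathrm{Dir}(a,\dots,a),\qquad \tau\sim\mathrm{Ga}(pa,1/2),\qquad \beta_j\mid\phi,\tau\sim\mathrm{DE}(\sigma\phi_j\tau)\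 \ (j=1,\dots,p),$$ where $\phi$ and $\tau$ are independent, the $\beta_j$ are conditionally independent given $(\phi,\tau)$, $\mathrm{Ga}(pa,1/2)$ has shape $pa$ and rate $1/2$, and $\mathrm{DE}(b)$ has density $(2b)^{-1}e^{-|y|/b}$ on $\mathbb R$. The posterior $\Pi_n(\cdot\mid Y_n)$ is obtained from this prior by Bayes' formula with the normal likelihood $N(X_n\beta,\sigma^2I_n)$. **Theorem.** Assume (A1)–(A3), $p_n=o(n)$ and $q_n=o(n/\log n)$, and let $a_n=C/(p_n n^{\rho}\log n)$ for finite constants $\rho>0$ and $C>0$. Then the Dirichlet–Laplace prior with $p=p_n$ and $a=a_n$ yields a consistent posterior: for every $\epsilon>0$, $$\Pi_n\big(\{\beta:\|\beta-\beta_n^0\|>\epsilon\}\mid Y_n\big)\longrightarrow 0\quad\text{in probability as } n\to\infty,$$ where $\|\cdot\|$ is the Euclidean norm. -/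

import Mathlib

open Filter Topology MeasureTheory ProbabilityTheory Asymptotics
open scoped ENNReal NNReal Matrix

namespace DLRegression

noncomputable section

/-- Density at `y` of the zero mean Laplace distribution `DE(b)`:
`(2b)⁻¹ exp (-|y| / b)`, for a scale `b > 0`. -/
def laplacePDF (b y : ℝ) : ℝ≥0∞ :=
  ENNReal.ofReal ((2 * b)⁻¹ * Real.exp (-|y| / b))

/-- Density of the symmetric Dirichlet distribution `Dir(a, …, a)` with `m + 1` components,
as a function of the first `m` components `x` (the last one is `1 - ∑ i, x i`). -/
def dirichletPDF (m : ℕ) (a : ℝ) (x : Fin m → ℝ) : ℝ≥0∞ :=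
  {x : Fin m → ℝ | (∀ i, 0 < x i) ∧ ∑ i, x i < 1}.indicator
    (fun x => ENNReal.ofReal
      (Real.Gamma ((m + 1) * a) / Real.Gamma a ^ (m + 1) *
        ((∏ i, x i ^ (a - 1)) * (1 - ∑ i, x i) ^ (a - 1)))) x

/-- The symmetric Dirichlet distribution `Dir(a, …, a)` on `ℝ^p`, carried by the unit simplex.
For `p = 1` it is the point mass at `1`; for `p = 0` there is no simplex, and the value is `0`. -/
def dirichletMeasure : (p : ℕ) → ℝ → Measure (Fin p → ℝ)
  | 0, _ => 0
  | m + 1, a =>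
      ((volume : Measure (Fin m → ℝ)).withDensity (dirichletPDF m a)).map
        (fun x => Fin.snoc (α := fun _ => ℝ) x (1 - ∑ i, x i))

/-- The joint law of `((φ, τ), β)` in the Dirichlet-Laplace hierarchy:
`φ ∼ Dir(a, …, a)` and `τ ∼ Ga(p a, 1/2)` (shape, rate) are independent and, given `(φ, τ)`, the
coordinates `β j ∼ DE(σ φ_j τ)` are independent. -/
def dlJoint (p : ℕ) (a σ : ℝ) : Measure (((Fin p → ℝ) × ℝ) × (Fin p → ℝ)) :=
  (((dirichletMeasure p a).prod (gammaMeasure (p * a) (1 / 2))).prod volume).withDensity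
    (fun z => ∏ j, laplacePDF (σ * z.1.1 j * z.1.2) (z.2 j))

/-- The Dirichlet-Laplace prior: the marginal law of the coefficient vector `β`. -/
def dlPrior (p : ℕ) (a σ : ℝ) : Measure (Fin p → ℝ) :=
  (dlJoint p a σ).map Prod.snd

/-- The normal likelihood of the response `y` in the linear regression model with design matrix
`X`, coefficient vector `β` and error variance `σ ^ 2`. -/
def likelihood {n p : ℕ} (X : Matrix (Fin n) (Fin p) ℝ) (σ : ℝ) (y : Fin n → ℝ)
    (β : Fin p → ℝ) : ℝ≥0∞ :=
  ∏ i, gaussianPDF ((X *ᵥ β) i) (σ ^ 2).toNNReal (y i)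

/-- The posterior distribution of `β` given `y`, by Bayes' formula: the law whose density with
respect to the prior is proportional to the likelihood. -/
def posterior {n p : ℕ} (prior : Measure (Fin p → ℝ)) (X : Matrix (Fin n) (Fin p) ℝ) (σ : ℝ)
    (y : Fin n → ℝ) : Measure (Fin p → ℝ) :=
  (∫⁻ β, likelihood X σ y β ∂prior)⁻¹ • prior.withDensity (likelihood X σ y)

/-- The scaled Gram matrix `Xᵀ X / n` of an `n × p` design matrix. -/
def gram {n p : ℕ} (X : Matrix (Fin n) (Fin p) ℝ) : Matrix (Fin p) (Fin p) ℝ :=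
  (n : ℝ)⁻¹ • (Xᵀ * X)

theorem gram_isHermitian {n p : ℕ} (X : Matrix (Fin n) (Fin p) ℝ) : (gram X).IsHermitian := by
  simp [gram, Matrix.IsHermitian, Matrix.conjTranspose_eq_transpose_of_trivial]

/-- The eigenvalues of `Xᵀ X / n`, with multiplicity. -/
def gramEigenvalues {n p : ℕ} (X : Matrix (Fin n) (Fin p) ℝ) : Fin p → ℝ :=
  (gram_isHermitian X).eigenvalues

end

end DLRegression

namespace DLRegression

/-! ### Products of independent integrals -/

/-! The log likelihood ratio at `β₀ + h` is `(⟨Xᵀe, h⟩ - ‖Xh‖² / 2) / σ²`. The eigenvalue bounds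
make `‖Xh‖²` comparable to `n‖h‖²`, so once `‖Xᵀe‖ ≤ η n` with `η` small, the ratio is exponentially
small in `n` outside the `ε`-ball and loses only a small exponential factor near the truth. Since
the prior has mass at most one, the posterior is small as soon as a small neighbourhood of the truth
has prior mass at least `exp (-c n)` for a small `c` (`posterior_le`). The noise event fails with
probability `O(p / n)` by Chebyshev (`measure_norm_vecMul_gt_le`); only second moments of the errors
enter.

For the prior mass, the variables `τ φ_j` are independent `Ga(a, 1/2)` by the beta-gamma identity
(`lintegral_dirichlet_prod_gamma`), so box probabilities factor (`dlPrior_pi`). A zero coordinate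
costs at most a factor `exp (-2)`, in total `exp (-2p)` with `p = o(n)`. A nonzero coordinate costs
a factor of order `a` times the side length, which is polynomial in `1/n`; the `q` of them cost `exp
(-O(q log n))` with `q log n = o(n)` (`eventually_dlPrior_box_ge`). -/

theorem lintegral_fin_prod_eq_prod {n : ℕ} {f : Fin n → ℝ → ℝ≥0∞} (hf : ∀ i, Measurable (f i)) :
    ∫⁻ x : Fin n → ℝ, ∏ i, f i (x i) = ∏ i, ∫⁻ x, f i x := by
  induction n with
  | zero => simp [volume_pi]
  | succ n ih =>
    have hm : Measurable fun x : Fin (n + 1) → ℝ => ∏ i, f i (x i) :=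
      Finset.measurable_prod _ fun i _ => (hf i).comp (measurable_pi_apply i)
    rw [← (volume_preserving_piFinSuccAbove (fun _ : Fin (n + 1) => ℝ) 0).symm.lintegral_comp hm]
    simp only [MeasurableEquiv.piFinSuccAbove_symm_apply, Fin.insertNthEquiv,
      Fin.prod_univ_succ, Fin.insertNth_zero, Equiv.coe_fn_mk, Fin.cons_succ, Fin.cons_zero,
      Fin.zero_succAbove, cast_eq]
    rw [Measure.volume_eq_prod, lintegral_prod_mul (f := f 0)
      (g := fun y : Fin n → ℝ => ∏ i, f i.succ (y i)) (hf 0).aemeasurable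
      (Finset.measurable_prod _ fun i _ => (hf _).comp (measurable_pi_apply i)).aemeasurable,
      ih fun i => hf i.succ]

/-- Change of variables `y = t • x` on `ℝ^m`. -/
theorem lintegral_smul_pi {m : ℕ} {t : ℝ} (ht : 0 < t) {H : (Fin m → ℝ) → ℝ≥0∞}
    (hH : Measurable H) :
    ∫⁻ x : Fin m → ℝ, ENNReal.ofReal (t ^ m) * H (t • x) = ∫⁻ y, H y := by
  have h1 : ∫⁻ x : Fin m → ℝ, H (t • x) = ENNReal.ofReal (t ^ m)⁻¹ * ∫⁻ y, H y := by
    have := Measure.map_addHaar_smul (volume : Measure (Fin m → ℝ)) ht.ne'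
    rw [← lintegral_map hH (measurable_const_smul t), this, lintegral_smul_measure]
    simp [abs_of_pos ht]
  have h2 : Measurable fun x : Fin m → ℝ => H (t • x) := hH.comp (measurable_const_smul t)
  rw [lintegral_const_mul _ h2, h1, ← mul_assoc,
    ← ENNReal.ofReal_mul (by positivity), mul_inv_cancel₀ (by positivity)]
  simp

/-! ### The beta-gamma identity -/

/-- At `x = 0` this relies on the convention `0 ^ (a - 1) = 0` for `a ≠ 1`. It makes the density
identity below hold at every point, including the boundary of the simplex. -/
theorem gammaPDF_of_nonpos {a r x : ℝ} (ha : a < 1) (hx : x ≤ 0) : gammaPDF a r x = 0 := by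
  rcases hx.lt_or_eq with h | rfl
  · exact gammaPDF_of_neg h
  · simp [gammaPDF_eq, Real.zero_rpow (sub_ne_zero.2 ha.ne)]

theorem measurable_gammaPDF (a r : ℝ) : Measurable (gammaPDF a r) :=
  (measurable_gammaPDFReal a r).ennreal_ofReal

theorem measurable_dirichletPDF (m : ℕ) (a : ℝ) : Measurable (dirichletPDF m a) := by
  have hs : MeasurableSet {x : Fin m → ℝ | (∀ i, 0 < x i) ∧ ∑ i, x i < 1} := by
    have h : Measurable fun x : Fin m → ℝ => ∑ i, x i := by fun_prop
    rw [Set.ofPred_and, Set.ofPred_forall]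
    exact (MeasurableSet.iInter fun i =>
      measurableSet_lt measurable_const (measurable_pi_apply i)).inter
      (measurableSet_lt h measurable_const)
  unfold dirichletPDF
  exact Measurable.indicator (by fun_prop) hs

/-- The density identity behind the independence of Gamma variables normalized by their sum. -/
theorem dirichletPDF_mul_gammaPDF {m : ℕ} {a r t : ℝ} (ha : 0 < a) (ha1 : a < 1) (hr : 0 < r)
    (ht : 0 < t) (x : Fin m → ℝ) :
    dirichletPDF m a x * gammaPDF ((m + 1) * a) r t =
      ENNReal.ofReal (t ^ m) *
        ((∏ i, gammaPDF a r (t * x i)) * gammaPDF a r (t - ∑ i, t * x i)) := by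
  by_cases hx : (∀ i, 0 < x i) ∧ ∑ i, x i < 1
  · obtain ⟨hx0, hx1⟩ := hx
    have h1 : 0 < 1 - ∑ i, x i := by linarith
    have hsum : t - ∑ i, t * x i = t * (1 - ∑ i, x i) := by rw [← Finset.mul_sum]; ring
    have hmem : x ∈ {x : Fin m → ℝ | (∀ i, 0 < x i) ∧ ∑ i, x i < 1} := ⟨hx0, hx1⟩
    have hG := Real.Gamma_pos_of_pos ha
    have hG2 : 0 < Real.Gamma ((m + 1) * a) := Real.Gamma_pos_of_pos (by positivity)
    rw [dirichletPDF, Set.indicator_of_mem hmem, hsum, gammaPDF_of_nonneg ht.le,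
      gammaPDF_of_nonneg (by positivity)]
    have : ∀ i, gammaPDF a r (t * x i) = ENNReal.ofReal (r ^ a / Real.Gamma a *
        (t * x i) ^ (a - 1) * Real.exp (-(r * (t * x i)))) := fun i =>
      gammaPDF_of_nonneg (mul_pos ht (hx0 i)).le
    simp only [this]
    have hx0' : ∀ i, 0 ≤ x i := fun i => (hx0 i).le
    have hp : ∀ i ∈ (Finset.univ : Finset (Fin m)), 0 ≤ r ^ a / Real.Gamma a *
        (t * x i) ^ (a - 1) * Real.exp (-(r * (t * x i))) := fun i _ => by
      have := hx0' i; positivity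
    have hprod : 0 ≤ ∏ i, x i ^ (a - 1) :=
      Finset.prod_nonneg fun i _ => Real.rpow_nonneg (hx0' i) _
    rw [← ENNReal.ofReal_prod_of_nonneg hp, ← ENNReal.ofReal_mul (by positivity),
      ← ENNReal.ofReal_mul (Finset.prod_nonneg hp), ← ENNReal.ofReal_mul (by positivity)]
    congr 1
    simp only [Finset.prod_mul_distrib, Finset.prod_const, Finset.card_univ, Fintype.card_fin,
      ← Real.exp_sum, Real.mul_rpow ht.le (hx0' _), Real.mul_rpow ht.le h1.le]
    have e1 : r ^ ((m + 1) * a : ℝ) = (r ^ a) ^ (m + 1) := by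
      rw [← Real.rpow_natCast, ← Real.rpow_mul hr.le]; congr 1; push_cast; ring
    -- The powers of `t` split into the Jacobian `t ^ m` and one factor `t ^ (a - 1)` for each of
    -- the `m + 1` Gamma densities.
    have e2 : t ^ ((m + 1) * a - 1 : ℝ) = t ^ m * (t ^ (a - 1)) ^ m * t ^ (a - 1) := by
      rw [← Real.rpow_natCast, ← Real.rpow_natCast, ← Real.rpow_mul ht.le, ← Real.rpow_add ht,
        ← Real.rpow_add ht]; congr 1; ring
    have e3 : Real.exp (-(r * t)) =
        Real.exp (∑ i, -(r * (t * x i))) * Real.exp (-(r * (t * (1 - ∑ i, x i)))) := by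
      rw [← Real.exp_add]; congr 1
      simp only [Finset.sum_neg_distrib, ← Finset.mul_sum]; ring
    rw [e1, e2, e3]
    rw [div_pow, mul_comm (r ^ a / _)]
    field_simp
    ring
  · have hmem : x ∉ {x : Fin m → ℝ | (∀ i, 0 < x i) ∧ ∑ i, x i < 1} := hx
    rw [dirichletPDF, Set.indicator_of_notMem hmem, zero_mul]
    symm
    rw [not_and_or, not_forall] at hx
    rcases hx with ⟨i, hi⟩ | hx
    · rw [Finset.prod_eq_zero (Finset.mem_univ i), zero_mul, mul_zero]
      exact gammaPDF_of_nonpos ha1 (mul_nonpos_of_nonneg_of_nonpos ht.le (not_lt.1 hi))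
    · rw [gammaPDF_of_nonpos ha1 (x := t - ∑ i, t * x i), mul_zero, mul_zero]
      rw [← Finset.mul_sum]
      nlinarith

theorem measurable_snoc_prod {m : ℕ} :
    Measurable fun w : (Fin m → ℝ) × ℝ =>
      (Fin.snoc (α := fun _ => ℝ) w.1 w.2 : Fin (m + 1) → ℝ) := by
  refine measurable_pi_iff.2 fun j => ?_
  refine Fin.lastCases ?_ (fun i => ?_) j
  · simpa only [Fin.snoc_last] using measurable_snd
  · simp only [Fin.snoc_castSucc]
    exact (measurable_pi_apply i).comp measurable_fst

/-- The integral over `t` is put outside, so that `x` can be rescaled by a fixed `t` afterwards. -/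
theorem lintegral_dirichlet_prod_gamma_eq {m : ℕ} {a b r : ℝ} (hb : 0 < b) (hr : 0 < r)
    {F : (Fin (m + 1) → ℝ) → ℝ≥0∞} (hF : Measurable F) :
    ∫⁻ w, F (w.2 • w.1) ∂((dirichletMeasure (m + 1) a).prod (gammaMeasure b r)) =
    ∫⁻ t, ∫⁻ x : Fin m → ℝ, dirichletPDF m a x * gammaPDF b r t *
      F (t • (Fin.snoc (α := fun _ => ℝ) x (1 - ∑ i, x i) : Fin (m + 1) → ℝ)) := by
  have : IsProbabilityMeasure (gammaMeasure b r) := isProbabilityMeasure_gammaMeasure hb hr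
  have hsn : Measurable fun x : Fin m → ℝ =>
      (Fin.snoc (α := fun _ => ℝ) x (1 - ∑ i, x i) : Fin (m + 1) → ℝ) :=
    measurable_snoc_prod.comp (measurable_id.prodMk (by fun_prop))
  have hF2 : Measurable fun w : (Fin (m + 1) → ℝ) × ℝ => F (w.2 • w.1) :=
    hF.comp (measurable_snd.smul measurable_fst)
  have hFt : Measurable fun φ : Fin (m + 1) → ℝ => ∫⁻ t, F (t • φ) ∂(gammaMeasure b r) :=
    hF2.lintegral_prod_right'
  have hFs : Measurable fun x : Fin m → ℝ => ∫⁻ t,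
      F (t • (Fin.snoc (α := fun _ => ℝ) x (1 - ∑ i, x i) : Fin (m + 1) → ℝ))
        ∂(gammaMeasure b r) := hFt.comp hsn
  have hg := measurable_gammaPDF b r
  have hd := measurable_dirichletPDF m a
  have hG : Measurable fun w : (Fin m → ℝ) × ℝ => dirichletPDF m a w.1 * gammaPDF b r w.2 *
      F (w.2 • (Fin.snoc (α := fun _ => ℝ) w.1 (1 - ∑ i, w.1 i) : Fin (m + 1) → ℝ)) :=
    ((hd.comp measurable_fst).mul (hg.comp measurable_snd)).mul
      (hF2.comp ((hsn.comp measurable_fst).prodMk measurable_snd))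
  rw [lintegral_prod _ hF2.aemeasurable, dirichletMeasure, lintegral_map hFt hsn,
    lintegral_withDensity_eq_lintegral_mul _ hd hFs,
    ← lintegral_lintegral_swap hG.aemeasurable]
  refine lintegral_congr fun x => ?_
  have hx : Measurable fun t : ℝ =>
      F (t • (Fin.snoc (α := fun _ => ℝ) x (1 - ∑ i, x i) : Fin (m + 1) → ℝ)) :=
    hF2.comp measurable_prodMk_left
  rw [Pi.mul_apply, gammaMeasure, lintegral_withDensity_eq_lintegral_mul _ hg hx,
    ← lintegral_const_mul _ (hg.mul hx)]
  simp only [Pi.mul_apply, mul_assoc]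

/-- If `φ ∼ Dir(a, …, a)` and `τ ∼ Ga((m + 1) a, r)` are independent, then the `τ * φ j` are
independent `Ga(a, r)` variables. -/
theorem lintegral_dirichlet_prod_gamma {m : ℕ} {a r : ℝ} (ha : 0 < a) (ha1 : a < 1) (hr : 0 < r)
    {F : (Fin (m + 1) → ℝ) → ℝ≥0∞} (hF : Measurable F) :
    ∫⁻ w, F (w.2 • w.1)
      ∂((dirichletMeasure (m + 1) a).prod (gammaMeasure ((m + 1) * a) r)) =
    ∫⁻ y : Fin m → ℝ, ∫⁻ t, (∏ i, gammaPDF a r (y i)) * gammaPDF a r t *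
      F (Fin.snoc (α := fun _ => ℝ) y t) := by
  have hg := measurable_gammaPDF a r
  have hprod : Measurable fun y : Fin m → ℝ => ∏ i, gammaPDF a r (y i) :=
    Finset.measurable_prod _ fun i _ => hg.comp (measurable_pi_apply i)
  have hsum : Measurable fun w : (Fin m → ℝ) × ℝ => w.2 - ∑ i, w.1 i := by fun_prop
  have hH : Measurable fun w : (Fin m → ℝ) × ℝ =>
      (∏ i, gammaPDF a r (w.1 i)) * gammaPDF a r (w.2 - ∑ i, w.1 i) *
        F (Fin.snoc (α := fun _ => ℝ) w.1 (w.2 - ∑ i, w.1 i)) :=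
    ((hprod.comp measurable_fst).mul (hg.comp hsum)).mul
      (hF.comp (measurable_snoc_prod.comp (measurable_fst.prodMk hsum)))
  have hHt : ∀ t : ℝ, Measurable fun y : Fin m → ℝ =>
      (∏ i, gammaPDF a r (y i)) * gammaPDF a r (t - ∑ i, y i) *
        F (Fin.snoc (α := fun _ => ℝ) y (t - ∑ i, y i)) :=
    fun t => hH.comp (f := fun y : Fin m → ℝ => (y, t)) (measurable_id.prodMk measurable_const)
  rw [lintegral_dirichlet_prod_gamma_eq (by positivity) hr hF]
  calc
    _ = ∫⁻ t, ∫⁻ y : Fin m → ℝ, (∏ i, gammaPDF a r (y i)) * gammaPDF a r (t - ∑ i, y i) *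
        F (Fin.snoc (α := fun _ => ℝ) y (t - ∑ i, y i)) := by
      refine lintegral_congr_ae ?_
      filter_upwards [Measure.ae_ne volume (0 : ℝ)] with t ht0
      rcases lt_or_gt_of_ne ht0 with ht | ht
      -- For `t < 0` the numbers `y i` and `t - ∑ y i` sum to `t`, so one of them is negative and
      -- its Gamma factor vanishes.
      · simp only [gammaPDF_of_neg ht, zero_mul, mul_zero, lintegral_zero]
        symm
        rw [lintegral_eq_zero_iff (hHt t)]
        refine Eventually.of_forall fun y => ?_
        by_cases hy : ∀ i, 0 ≤ y i
        · have : t - ∑ i, y i < 0 := by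
            have := Finset.sum_nonneg fun i (_ : i ∈ Finset.univ) => hy i
            linarith
          simp [gammaPDF_of_neg this]
        · push Not at hy
          obtain ⟨i, hi⟩ := hy
          have : ∏ i, gammaPDF a r (y i) = 0 :=
            Finset.prod_eq_zero (Finset.mem_univ i) (gammaPDF_of_neg hi)
          simp [this]
      · rw [← lintegral_smul_pi ht (hHt t)]
        refine lintegral_congr fun x => ?_
        have e : t • (Fin.snoc (α := fun _ => ℝ) x (1 - ∑ i, x i) : Fin (m + 1) → ℝ) =
            Fin.snoc (α := fun _ => ℝ) (t • x) (t - ∑ i, t * x i) := by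
          ext j
          refine Fin.lastCases ?_ (fun i => ?_) j
          · simp only [Pi.smul_apply, Fin.snoc_last, smul_eq_mul, ← Finset.mul_sum]
            ring
          · simp only [Pi.smul_apply, Fin.snoc_castSucc]
        rw [dirichletPDF_mul_gammaPDF ha ha1 hr ht x, e]
        simp only [Pi.smul_apply, smul_eq_mul, mul_assoc]
    _ = ∫⁻ y : Fin m → ℝ, ∫⁻ t, (∏ i, gammaPDF a r (y i)) * gammaPDF a r (t - ∑ i, y i) *
        F (Fin.snoc (α := fun _ => ℝ) y (t - ∑ i, y i)) :=
      (lintegral_lintegral_swap hH.aemeasurable).symm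
    _ = _ := by
      refine lintegral_congr fun y => ?_
      -- For fixed `y`, the translation by `∑ y i` turns the total `t` into the last component.
      exact lintegral_sub_right_eq_self (fun t => (∏ i, gammaPDF a r (y i)) * gammaPDF a r t *
        F (Fin.snoc (α := fun _ => ℝ) y t)) _

theorem lintegral_dirichlet_prod_gamma_prod {m : ℕ} {a r : ℝ} (ha : 0 < a) (ha1 : a < 1)
    (hr : 0 < r) {k : Fin (m + 1) → ℝ → ℝ≥0∞} (hk : ∀ j, Measurable (k j)) :
    ∫⁻ w, ∏ j, k j (w.2 * w.1 j)
      ∂((dirichletMeasure (m + 1) a).prod (gammaMeasure ((m + 1) * a) r)) =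
    ∏ j, ∫⁻ s, k j s ∂(gammaMeasure a r) := by
  have hg := measurable_gammaPDF a r
  have hm : ∀ j : Fin (m + 1), Measurable fun s => gammaPDF a r s * k j s :=
    fun j => hg.mul (hk j)
  have hm' : Measurable fun y : Fin m → ℝ =>
      ∏ i : Fin m, gammaPDF a r (y i) * k i.castSucc (y i) :=
    Finset.measurable_prod _ fun i _ => (hm i.castSucc).comp (measurable_pi_apply i)
  have hF : Measurable fun v : Fin (m + 1) → ℝ => ∏ j, k j (v j) :=
    Finset.measurable_prod _ fun j _ => (hk j).comp (measurable_pi_apply j)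
  have := lintegral_dirichlet_prod_gamma ha ha1 hr hF
  simp only [Pi.smul_apply, smul_eq_mul] at this
  have e : ∀ j, ∫⁻ s, k j s ∂(gammaMeasure a r) = ∫⁻ s, gammaPDF a r s * k j s := fun j =>
    lintegral_withDensity_eq_lintegral_mul _ hg (hk j)
  rw [this, Fin.prod_univ_castSucc]
  simp only [e]
  rw [← lintegral_fin_prod_eq_prod fun i : Fin m => hm i.castSucc, ← lintegral_mul_const _ hm']
  refine lintegral_congr fun y => ?_
  rw [← lintegral_const_mul _ (hm _)]
  refine lintegral_congr fun t => ?_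
  rw [Fin.prod_univ_castSucc, Finset.prod_mul_distrib]
  simp only [Fin.snoc_castSucc, Fin.snoc_last]
  ring

/-! ### The Dirichlet-Laplace prior of a box -/

theorem measurable_laplacePDF : Measurable fun z : ℝ × ℝ => laplacePDF z.1 z.2 := by
  unfold laplacePDF
  have : Measurable fun z : ℝ × ℝ => |z.2| := measurable_snd.abs
  fun_prop

/-- The coordinates of the Dirichlet-Laplace prior are independent, each of them a mixture of
Laplace distributions with a Gamma distributed scale. -/
theorem dlPrior_pi {p : ℕ} (hp : 0 < p) {a σ : ℝ} (ha : 0 < a) (ha1 : a < 1)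
    {s : Fin p → Set ℝ} (hs : ∀ j, MeasurableSet (s j)) :
    dlPrior p a σ (Set.univ.pi s) =
      ∏ j, ∫⁻ t, (∫⁻ y in s j, laplacePDF (σ * t) y) ∂(gammaMeasure a (1 / 2)) := by
  obtain ⟨m, rfl⟩ : ∃ m, p = m + 1 := ⟨p - 1, by omega⟩
  have : IsProbabilityMeasure (gammaMeasure ((m + 1 : ℕ) * a) (1 / 2)) :=
    isProbabilityMeasure_gammaMeasure (by positivity) (by norm_num)
  have : SFinite (dirichletMeasure (m + 1) a) := by unfold dirichletMeasure; infer_instance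
  have hbox : MeasurableSet (Set.univ.pi s) := MeasurableSet.univ_pi hs
  have hk : ∀ j, Measurable fun z : ℝ × ℝ => (s j).indicator (laplacePDF (σ * z.1)) z.2 := by
    intro j
    have h1 : Measurable fun z : ℝ × ℝ => laplacePDF (σ * z.1) z.2 :=
      measurable_laplacePDF.comp ((measurable_fst.const_mul σ).prodMk measurable_snd)
    exact h1.indicator (measurable_snd (hs j))
  have hz : ∀ j : Fin (m + 1),
      Measurable fun z : ((Fin (m + 1) → ℝ) × ℝ) × (Fin (m + 1) → ℝ) =>
        (z.1.2 * z.1.1 j, z.2 j) := fun j => by fun_prop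
  have hF : Measurable fun z : ((Fin (m + 1) → ℝ) × ℝ) × (Fin (m + 1) → ℝ) =>
      ∏ j : Fin (m + 1), (s j).indicator (laplacePDF (σ * (z.1.2 * z.1.1 j))) (z.2 j) :=
    Finset.measurable_prod _ fun j _ => (hk j).comp (hz j)
  calc
    _ = ∫⁻ z : ((Fin (m + 1) → ℝ) × ℝ) × (Fin (m + 1) → ℝ),
        ∏ j : Fin (m + 1), (s j).indicator (laplacePDF (σ * (z.1.2 * z.1.1 j))) (z.2 j)
        ∂(((dirichletMeasure (m + 1) a).prod
          (gammaMeasure ((m + 1 : ℕ) * a) (1 / 2))).prod volume) := by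
      rw [dlPrior, Measure.map_apply measurable_snd hbox, dlJoint,
        withDensity_apply _ (measurable_snd hbox), ← lintegral_indicator (measurable_snd hbox)]
      refine lintegral_congr fun z => ?_
      by_cases hz : z.2 ∈ Set.univ.pi s
      · rw [Set.indicator_of_mem (by exact hz)]
        refine Finset.prod_congr rfl fun j _ => ?_
        rw [Set.indicator_of_mem (hz j trivial), mul_assoc, mul_comm z.1.2]
      · rw [Set.indicator_of_notMem (by exact hz)]
        simp only [Set.mem_pi, Set.mem_univ, forall_const, not_forall] at hz
        obtain ⟨j, hj⟩ := hz
        rw [Finset.prod_eq_zero (Finset.mem_univ j) (Set.indicator_of_notMem hj _)]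
    _ = ∫⁻ w, ∏ j, (fun t => ∫⁻ y in s j, laplacePDF (σ * t) y) (w.2 * w.1 j)
        ∂((dirichletMeasure (m + 1) a).prod (gammaMeasure ((m + 1 : ℕ) * a) (1 / 2))) := by
      rw [lintegral_prod _ hF.aemeasurable]
      refine lintegral_congr fun w => ?_
      rw [lintegral_fin_prod_eq_prod
        (f := fun j y => (s j).indicator (laplacePDF (σ * (w.2 * w.1 j))) y)
        fun j => (hk j).comp (measurable_const.prodMk measurable_id)]
      exact Finset.prod_congr rfl fun j _ => lintegral_indicator (hs j) _
    _ = _ := by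
      push_cast
      refine lintegral_dirichlet_prod_gamma_prod ha ha1 (r := 1 / 2) (by norm_num)
        (k := fun j t => ∫⁻ y in s j, laplacePDF (σ * t) y) fun j => ?_
      simp only [← lintegral_indicator (hs j)]
      exact (hk j).lintegral_prod_right'

/-! ### Bounds for one coordinate -/

theorem lintegral_laplacePDF_le_one (b : ℝ) : ∫⁻ y, laplacePDF b y ≤ 1 := by
  rcases le_or_gt b 0 with hb | hb
  · have : ∀ y, laplacePDF b y = 0 := fun y => by
      rw [laplacePDF, ENNReal.ofReal_eq_zero]
      exact mul_nonpos_of_nonpos_of_nonneg (inv_nonpos.2 (by linarith)) (Real.exp_pos _).le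
    simp [this]
  · have h1 : ∫ y : ℝ, Real.exp (-|y| / b) = 2 * b := by
      rw [integral_comp_abs (f := fun x => Real.exp (-x / b))]
      have : ∀ x : ℝ, -x / b = -b⁻¹ * x := fun x => by ring
      simp only [this]
      rw [integral_exp_mul_Ioi (by simpa using hb)]
      simp
    have h2 : Integrable fun y : ℝ => Real.exp (-|y| / b) := by
      -- A non-integrable function would have Bochner integral `0`, not `2 * b`.
      by_contra h
      rw [integral_undef h] at h1
      linarith
    unfold laplacePDF
    rw [← ofReal_integral_eq_lintegral_ofReal (h2.const_mul _)
      (Eventually.of_forall fun y => by positivity), integral_const_mul, h1,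
      inv_mul_cancel₀ (by positivity)]
    simp

/-- Markov's inequality with mean `a / r`: multiplying the `Ga(a, r)` density by `t` gives `a / r`
times the `Ga(a + 1, r)` density, and `1 ≤ t / s` on the half line. -/
theorem gammaMeasure_Ioi_le {a r s : ℝ} (ha : 0 < a) (hr : 0 < r) (hs : 0 < s) :
    gammaMeasure a r (Set.Ioi s) ≤ ENNReal.ofReal (a / (r * s)) := by
  rw [gammaMeasure, withDensity_apply _ measurableSet_Ioi]
  calc
    _ ≤ ∫⁻ t in Set.Ioi s, ENNReal.ofReal (a / (r * s)) * gammaPDF (a + 1) r t := by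
      refine setLIntegral_mono' measurableSet_Ioi fun t (ht : s < t) => ?_
      have ht0 : 0 < t := hs.trans ht
      rw [gammaPDF_of_nonneg ht0.le, gammaPDF_of_nonneg ht0.le, ← ENNReal.ofReal_mul (by positivity)]
      refine ENNReal.ofReal_le_ofReal ?_
      have hG := Real.Gamma_pos_of_pos ha
      have e1 : r ^ (a + 1) = r ^ a * r := Real.rpow_add_one hr.ne' a
      have e2 : t ^ (a + 1 - 1) = t ^ (a - 1) * t := by
        rw [← Real.rpow_add_one ht0.ne']; congr 1; ring
      rw [Real.Gamma_add_one ha.ne', e1, e2]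
      have : a / (r * s) * (r ^ a * r / (a * Real.Gamma a) * (t ^ (a - 1) * t) *
          Real.exp (-(r * t))) =
          t / s * (r ^ a / Real.Gamma a * t ^ (a - 1) * Real.exp (-(r * t))) := by
        field_simp
      rw [this]
      refine le_mul_of_one_le_left (by positivity) ?_
      rw [one_le_div hs]
      exact ht.le
    _ ≤ ∫⁻ t, ENNReal.ofReal (a / (r * s)) * gammaPDF (a + 1) r t := setLIntegral_le_lintegral _ _
    _ = _ := by
      rw [lintegral_const_mul _ (measurable_gammaPDF _ _),
        lintegral_gammaPDF_eq_one (by positivity) hr, mul_one]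

theorem gammaMeasure_ae_pos {a : ℝ} (r : ℝ) (ha1 : a < 1) :
    ∀ᵐ t ∂(gammaMeasure a r), 0 < t := by
  rw [gammaMeasure, ae_withDensity_iff (measurable_gammaPDF a r)]
  refine Eventually.of_forall fun t ht => ?_
  by_contra h
  exact ht (gammaPDF_of_nonpos ha1 (not_lt.1 h))

/-- Lower bound for a mixture of set integrals by restricting the mixing variable. -/
theorem mul_measure_le_lintegral {μ : Measure ℝ} {f : ℝ → ℝ≥0∞} {s : Set ℝ}
    (hs : MeasurableSet s) {c : ℝ≥0∞} (h : ∀ᵐ t ∂μ, t ∈ s → c ≤ f t) :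
    c * μ s ≤ ∫⁻ t, f t ∂μ := by
  rw [← setLIntegral_const]
  exact (setLIntegral_mono_ae' hs h).trans (setLIntegral_le_lintegral _ _)

/-- A coordinate of the prior lies near the origin with probability bounded below. -/
theorem exp_neg_two_le_lintegral_laplace {a σ t : ℝ} (ha : 0 < a) (ha1 : a < 1) (hσ : 0 < σ)
    (ht : 4 * a * σ ≤ t) :
    ENNReal.ofReal (Real.exp (-2)) ≤
      ∫⁻ s, (∫⁻ y in Set.Icc (-t) t, laplacePDF (σ * s) y) ∂(gammaMeasure a (1 / 2)) := by
  have ht0 : 0 < t := lt_of_lt_of_le (by positivity) ht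
  have : IsProbabilityMeasure (gammaMeasure a (1 / 2)) :=
    isProbabilityMeasure_gammaMeasure ha (by norm_num)
  -- The mixing law has mean `2 * a` and `t / σ ≥ 4 * a`, so Markov leaves at least half of the mass
  -- below `t / σ`.
  have hmass : ENNReal.ofReal (1 / 2) ≤ gammaMeasure a (1 / 2) (Set.Iic (t / σ)) := by
    rw [← Set.compl_Ioi, prob_compl_eq_one_sub measurableSet_Ioi]
    have h1 : gammaMeasure a (1 / 2) (Set.Ioi (t / σ)) ≤ ENNReal.ofReal (1 / 2) := by
      refine (gammaMeasure_Ioi_le ha (by norm_num) (by positivity)).trans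
        (ENNReal.ofReal_le_ofReal ?_)
      rw [div_le_iff₀ (by positivity)]
      have : 4 * a ≤ t / σ := by rw [le_div_iff₀ hσ]; exact ht
      linarith
    calc ENNReal.ofReal (1 / 2) = 1 - ENNReal.ofReal (1 / 2) := by
          rw [← ENNReal.ofReal_one, ← ENNReal.ofReal_sub _ (by norm_num)]; norm_num
      _ ≤ _ := tsub_le_tsub_left h1 _
  have hin : ∀ᵐ s ∂(gammaMeasure a (1 / 2)), s ∈ Set.Iic (t / σ) →
      ENNReal.ofReal (Real.exp (-1)) ≤ ∫⁻ y in Set.Icc (-t) t, laplacePDF (σ * s) y := by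
    filter_upwards [gammaMeasure_ae_pos (1 / 2) ha1] with s hs0 hs
    set b := σ * s with hb
    have hb0 : 0 < b := by positivity
    have hbt : b ≤ t := by
      have : s ≤ t / σ := hs
      rw [le_div_iff₀ hσ] at this
      linarith
    -- Within one scale `b ≤ t` of the origin the Laplace density is at least `exp (-1) / (2 * b)`.
    calc
      _ = ENNReal.ofReal ((2 * b)⁻¹ * Real.exp (-1)) * volume (Set.Icc (-b) b) := by
        rw [Real.volume_Icc, ← ENNReal.ofReal_mul (by positivity)]
        congr 1
        field_simp
        ring
      _ = ∫⁻ y in Set.Icc (-b) b, ENNReal.ofReal ((2 * b)⁻¹ * Real.exp (-1)) :=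
        (setLIntegral_const _ _).symm
      _ ≤ ∫⁻ y in Set.Icc (-b) b, laplacePDF b y := by
        refine setLIntegral_mono' measurableSet_Icc fun y hy => ?_
        refine ENNReal.ofReal_le_ofReal (mul_le_mul_of_nonneg_left ?_ (by positivity))
        rw [Real.exp_le_exp, neg_div, neg_le_neg_iff, div_le_one hb0]
        exact abs_le.2 hy
      _ ≤ _ := lintegral_mono_set (Set.Icc_subset_Icc (by linarith) hbt)
  refine le_trans ?_ (mul_measure_le_lintegral measurableSet_Iic hin)
  refine le_trans ?_ (mul_le_mul_right hmass _)
  rw [← ENNReal.ofReal_mul (by positivity)]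
  refine ENNReal.ofReal_le_ofReal ?_
  have : Real.exp (-2) = Real.exp (-1) * Real.exp (-1) := by rw [← Real.exp_add]; norm_num
  rw [this]
  refine mul_le_mul_of_nonneg_left ?_ (by positivity)
  rw [Real.exp_neg, one_div]
  refine inv_anti₀ (by norm_num) ?_
  linarith [Real.add_one_le_exp 1]

/-- Convexity of `Γ` between `Γ 1 = Γ 2 = 1`. -/
theorem Gamma_add_one_le_one {a : ℝ} (ha : 0 < a) (ha1 : a < 1) : Real.Gamma (a + 1) ≤ 1 := by
  have := Real.convexOn_Gamma.2 (show (1 : ℝ) ∈ Set.Ioi 0 by simp)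
    (show (2 : ℝ) ∈ Set.Ioi 0 by simp) (sub_nonneg.2 ha1.le) ha.le (by ring)
  simp only [smul_eq_mul, Real.Gamma_one, Real.Gamma_two] at this
  have e : (1 - a) * 1 + a * 2 = a + 1 := by ring
  rw [e] at this
  linarith

/-- The bound is linear in `a` because `1 / Γ(a) = a / Γ(a + 1) ≥ a`. Hence a nonzero coordinate
costs only a power of `n` when `a` is polynomially small. -/
theorem gammaMeasure_Icc_one_two_ge {a : ℝ} (ha : 0 < a) (ha1 : a < 1) :
    ENNReal.ofReal (a * (Real.exp (-1) / 4)) ≤ gammaMeasure a (1 / 2) (Set.Icc 1 2) := by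
  rw [gammaMeasure, withDensity_apply _ measurableSet_Icc]
  calc
    _ = ∫⁻ x in Set.Icc (1 : ℝ) 2, ENNReal.ofReal (a * (Real.exp (-1) / 4)) := by
      rw [setLIntegral_const, Real.volume_Icc]; norm_num
    _ ≤ _ := by
      refine setLIntegral_mono' measurableSet_Icc fun x hx => ?_
      have hx0 : 0 < x := lt_of_lt_of_le one_pos hx.1
      rw [gammaPDF_of_nonneg hx0.le]
      refine ENNReal.ofReal_le_ofReal ?_
      have hG := Real.Gamma_pos_of_pos ha
      have h1 : (1 / 2 : ℝ) ≤ (1 / 2) ^ a := by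
        simpa using Real.rpow_le_rpow_of_exponent_ge (x := (1 / 2 : ℝ)) (by norm_num)
          (by norm_num) ha1.le
      have h2 : a ≤ 1 / Real.Gamma a := by
        rw [le_div_iff₀ hG, ← Real.Gamma_add_one ha.ne']
        exact Gamma_add_one_le_one ha ha1
      have h3 : (1 / 2 : ℝ) ≤ x ^ (a - 1) := by
        have : x ^ (-1 : ℝ) ≤ x ^ (a - 1) :=
          Real.rpow_le_rpow_of_exponent_le hx.1 (by linarith)
        refine le_trans ?_ this
        rw [Real.rpow_neg_one, one_div]
        exact inv_anti₀ hx0 hx.2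
      have h4 : Real.exp (-1) ≤ Real.exp (-(1 / 2 * x)) := by
        rw [Real.exp_le_exp]; linarith [hx.2]
      calc a * (Real.exp (-1) / 4) = 1 / 2 * a * (1 / 2) * Real.exp (-1) := by ring
        _ ≤ (1 / 2) ^ a * (1 / Real.Gamma a) * x ^ (a - 1) * Real.exp (-(1 / 2 * x)) := by
          gcongr
        _ = _ := by ring

/-- The constant of `mul_le_lintegral_laplace`. -/
noncomputable def slabConst (σ M : ℝ) : ℝ :=
  (2 * σ)⁻¹ * Real.exp (-(M + 1) / σ) * (Real.exp (-1) / 4)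

theorem slabConst_pos {σ : ℝ} (M : ℝ) (hσ : 0 < σ) : 0 < slabConst σ M := by
  unfold slabConst; positivity

/-- Lower bound for the prior probability of a short interval with bounded center. -/
theorem mul_le_lintegral_laplace {a σ t c M : ℝ} (ha : 0 < a) (ha1 : a < 1) (hσ : 0 < σ)
    (ht : 0 < t) (ht1 : t ≤ 1) (hc : |c| ≤ M) :
    ENNReal.ofReal (slabConst σ M * a * t) ≤
      ∫⁻ s, (∫⁻ y in Set.Icc (c - t) (c + t), laplacePDF (σ * s) y)
        ∂(gammaMeasure a (1 / 2)) := by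
  -- For mixing values in `[1, 2]` the scale lies in `[σ, 2σ]`, and the interval lies in `[-(M + 1),
  -- M + 1]`; this bounds the Laplace density from below uniformly.
  have hin : ∀ᵐ s ∂(gammaMeasure a (1 / 2)), s ∈ Set.Icc (1 : ℝ) 2 →
      ENNReal.ofReal ((2 * σ)⁻¹ * Real.exp (-(M + 1) / σ) * t) ≤
        ∫⁻ y in Set.Icc (c - t) (c + t), laplacePDF (σ * s) y := by
    refine Eventually.of_forall fun s hs => ?_
    have hs0 : 0 < s := lt_of_lt_of_le one_pos hs.1
    calc
      _ = ENNReal.ofReal ((4 * σ)⁻¹ * Real.exp (-(M + 1) / σ)) *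
          volume (Set.Icc (c - t) (c + t)) := by
        rw [Real.volume_Icc, ← ENNReal.ofReal_mul (by positivity)]
        congr 1
        field_simp
        ring
      _ = ∫⁻ y in Set.Icc (c - t) (c + t),
          ENNReal.ofReal ((4 * σ)⁻¹ * Real.exp (-(M + 1) / σ)) := (setLIntegral_const _ _).symm
      _ ≤ _ := by
        refine setLIntegral_mono' measurableSet_Icc fun y hy => ?_
        refine ENNReal.ofReal_le_ofReal (mul_le_mul ?_ ?_ (by positivity) (by positivity))
        · refine inv_anti₀ (by positivity) ?_
          nlinarith [hs.2]
        · rw [Real.exp_le_exp, neg_div, neg_div, neg_le_neg_iff]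
          have hy1 : |y| ≤ M + 1 := by
            have := abs_le.1 hc
            exact abs_le.2 ⟨by linarith [hy.1], by linarith [hy.2]⟩
          refine div_le_div₀ ((abs_nonneg y).trans hy1) hy1 hσ ?_
          nlinarith [hs.1]
  refine le_trans ?_ (mul_measure_le_lintegral measurableSet_Icc hin)
  refine le_trans ?_ (mul_le_mul_right (gammaMeasure_Icc_one_two_ge ha ha1) _)
  rw [← ENNReal.ofReal_mul (by positivity)]
  refine ENNReal.ofReal_le_ofReal (le_of_eq ?_)
  unfold slabConst
  ring

/-! ### Bounds for the prior -/

theorem dlPrior_univ_le_one {p : ℕ} (hp : 0 < p) {a σ : ℝ} (ha : 0 < a) (ha1 : a < 1) :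
    dlPrior p a σ Set.univ ≤ 1 := by
  have : IsProbabilityMeasure (gammaMeasure a (1 / 2)) :=
    isProbabilityMeasure_gammaMeasure ha (by norm_num)
  rw [← Set.pi_univ Set.univ, dlPrior_pi hp ha ha1 fun _ => MeasurableSet.univ]
  refine Finset.prod_le_one' fun j _ => ?_
  calc
    _ ≤ ∫⁻ _, 1 ∂(gammaMeasure a (1 / 2)) := lintegral_mono fun t => by
      rw [setLIntegral_univ]; exact lintegral_laplacePDF_le_one _
    _ = 1 := by rw [lintegral_one, measure_univ]

/-- Prior concentration around a bounded sparse vector. -/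
theorem dlPrior_box_ge {p : ℕ} (hp : 0 < p) {a σ t M : ℝ} (ha : 0 < a) (ha1 : a < 1)
    (hσ : 0 < σ) (ht : 4 * a * σ ≤ t) (ht1 : t ≤ 1) {β₀ : Fin p → ℝ} (hβ : ∀ j, |β₀ j| ≤ M) :
    ENNReal.ofReal (Real.exp (-2) ^ p *
        (slabConst σ M * a * t) ^ ({j | β₀ j ≠ 0} : Set (Fin p)).ncard) ≤
      dlPrior p a σ {β | ∀ j, |β j - β₀ j| ≤ t} := by
  classical
  have ht0 : 0 < t := lt_of_lt_of_le (by positivity) ht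
  have hκ := slabConst_pos M hσ
  have hset : {β : Fin p → ℝ | ∀ j, |β j - β₀ j| ≤ t} =
      Set.univ.pi fun j => Set.Icc (β₀ j - t) (β₀ j + t) := by
    ext β
    simp only [Set.mem_ofPred_eq, Set.mem_pi, Set.mem_univ, forall_const, Set.mem_Icc, abs_le]
    refine forall_congr' fun j => ⟨fun h => ⟨?_, ?_⟩, fun h => ⟨?_, ?_⟩⟩ <;> linarith [h.1, h.2]
  have hcard : ({j | β₀ j ≠ 0} : Set (Fin p)).ncard =
      (Finset.univ.filter fun j => β₀ j ≠ 0).card := by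
    rw [Set.ncard_eq_toFinset_card']; congr 1; ext; simp
  rw [hset, dlPrior_pi hp ha ha1 fun _ => measurableSet_Icc]
  calc
    _ ≤ ENNReal.ofReal (∏ j, if β₀ j ≠ 0 then slabConst σ M * a * t else Real.exp (-2)) := by
      refine ENNReal.ofReal_le_ofReal ?_
      rw [Finset.prod_ite, Finset.prod_const, Finset.prod_const, hcard, mul_comm]
      refine mul_le_mul_of_nonneg_left ?_ (by positivity)
      -- There are only `p - q` zero coordinates; the exponent may be raised to `p` since `exp (-2)
      -- ≤ 1`.
      refine pow_le_pow_of_le_one (by positivity) (Real.exp_le_one_iff.2 (by norm_num)) ?_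
      exact (Finset.card_filter_le _ _).trans (by simp)
    _ = ∏ j, ENNReal.ofReal (if β₀ j ≠ 0 then slabConst σ M * a * t else Real.exp (-2)) :=
      ENNReal.ofReal_prod_of_nonneg fun j _ => by split_ifs <;> positivity
    _ ≤ _ := by
      refine Finset.prod_le_prod' fun j _ => ?_
      split_ifs with h
      · exact mul_le_lintegral_laplace ha ha1 hσ ht0 ht1 (hβ j)
      · rw [not_not.1 h, zero_sub, zero_add]
        exact exp_neg_two_le_lintegral_laplace ha ha1 hσ ht

/-! ### Quadratic forms of the Gram matrix -/

/-- The `c i` are the coordinates of `v` in an orthonormal eigenbasis; both Rayleigh bounds follow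
from this one expansion. -/
theorem exists_diagonalization {p : ℕ} {A : Matrix (Fin p) (Fin p) ℝ} (hA : A.IsHermitian)
    (v : Fin p → ℝ) : ∃ c : Fin p → ℝ,
      v ⬝ᵥ v = ∑ i, c i ^ 2 ∧ v ⬝ᵥ A *ᵥ v = ∑ i, hA.eigenvalues i * c i ^ 2 := by
  set b := hA.eigenvectorBasis
  have key : ∀ u : Fin p → ℝ, v ⬝ᵥ u = ∑ i, (v ⬝ᵥ (b i).ofLp) * ((b i).ofLp ⬝ᵥ u) := fun u => by
    have := b.sum_inner_mul_inner (WithLp.toLp 2 v) (WithLp.toLp 2 u)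
    simp only [EuclideanSpace.inner_eq_star_dotProduct, star_trivial] at this
    rw [dotProduct_comm v u, ← this]
    exact Finset.sum_congr rfl fun i _ => by rw [dotProduct_comm v, dotProduct_comm u]
  refine ⟨fun i => v ⬝ᵥ (b i).ofLp, ?_, ?_⟩
  · rw [key v]
    exact Finset.sum_congr rfl fun i _ => by rw [dotProduct_comm (b i).ofLp v, sq]
  · rw [key]
    refine Finset.sum_congr rfl fun i _ => ?_
    have h1 : (b i).ofLp ⬝ᵥ A *ᵥ v = hA.eigenvalues i * (v ⬝ᵥ (b i).ofLp) := by
      rw [Matrix.dotProduct_mulVec, ← Matrix.mulVec_transpose,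
        show Aᵀ = A by simpa [Matrix.conjTranspose_eq_transpose_of_trivial] using hA.eq,
        hA.mulVec_eigenvectorBasis, smul_dotProduct, smul_eq_mul, dotProduct_comm]
    rw [h1]
    ring

theorem mulVec_dotProduct_self {n p : ℕ} (hn : 0 < n) (X : Matrix (Fin n) (Fin p) ℝ)
    (h : Fin p → ℝ) : (X *ᵥ h) ⬝ᵥ (X *ᵥ h) = n * (h ⬝ᵥ gram X *ᵥ h) := by
  have hn' : (n : ℝ) ≠ 0 := by positivity
  rw [gram, Matrix.smul_mulVec, dotProduct_smul, smul_eq_mul, mul_inv_cancel_left₀ hn',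
    ← Matrix.mulVec_mulVec, Matrix.dotProduct_mulVec h, Matrix.vecMul_transpose]

theorem mulVec_dotProduct_self_ge {n p : ℕ} (hn : 0 < n) {X : Matrix (Fin n) (Fin p) ℝ} {d : ℝ}
    (hd : ∀ j, d ≤ gramEigenvalues X j) (h : Fin p → ℝ) :
    n * d * (h ⬝ᵥ h) ≤ (X *ᵥ h) ⬝ᵥ (X *ᵥ h) := by
  obtain ⟨c, h1, h2⟩ := exists_diagonalization (gram_isHermitian X) h
  rw [mulVec_dotProduct_self hn, mul_assoc, h1, h2, Finset.mul_sum]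
  gcongr with i
  exact hd i

theorem mulVec_dotProduct_self_le {n p : ℕ} (hn : 0 < n) {X : Matrix (Fin n) (Fin p) ℝ} {D : ℝ}
    (hD : ∀ j, gramEigenvalues X j ≤ D) (h : Fin p → ℝ) :
    (X *ᵥ h) ⬝ᵥ (X *ᵥ h) ≤ n * D * (h ⬝ᵥ h) := by
  obtain ⟨c, h1, h2⟩ := exists_diagonalization (gram_isHermitian X) h
  rw [mulVec_dotProduct_self hn, mul_assoc, h1, h2,
    Finset.mul_sum _ _ D]
  gcongr with i
  exact hD i

theorem norm_toLp_sq {p : ℕ} (h : Fin p → ℝ) : ‖WithLp.toLp 2 h‖ ^ 2 = h ⬝ᵥ h := by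
  rw [EuclideanSpace.real_norm_sq_eq, dotProduct]
  exact Finset.sum_congr rfl fun i _ => sq _

theorem abs_dotProduct_le {p : ℕ} (v h : Fin p → ℝ) :
    |v ⬝ᵥ h| ≤ ‖WithLp.toLp 2 v‖ * ‖WithLp.toLp 2 h‖ := by
  refine abs_le_of_sq_le_sq ?_ (by positivity)
  rw [mul_pow, norm_toLp_sq, norm_toLp_sq]
  have := Finset.sum_mul_sq_le_sq_mul_sq Finset.univ v h
  simpa only [dotProduct, sq] using this

/-! ### The likelihood and the posterior -/

/-- The likelihood at a deviation `h` from the truth, relative to its value at the truth. -/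
theorem likelihood_eq {n p : ℕ} (X : Matrix (Fin n) (Fin p) ℝ) {σ : ℝ} (hσ : 0 < σ)
    (β₀ : Fin p → ℝ) (e : Fin n → ℝ) : ∃ L : ℝ, 0 < L ∧ ∀ β,
      likelihood X σ (X *ᵥ β₀ + e) β = ENNReal.ofReal (L * Real.exp
        (((e ᵥ* X) ⬝ᵥ (β - β₀) - (X *ᵥ (β - β₀)) ⬝ᵥ (X *ᵥ (β - β₀)) / 2) / σ ^ 2)) := by
  -- The constant is the likelihood at the truth; it does not depend on `β` and cancels in the
  -- posterior.
  refine ⟨(√(2 * Real.pi * σ ^ 2))⁻¹ ^ n * Real.exp (-(e ⬝ᵥ e) / (2 * σ ^ 2)), by positivity,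
    fun β => ?_⟩
  have hv : ((σ ^ 2).toNNReal : ℝ) = σ ^ 2 := Real.coe_toNNReal _ (by positivity)
  unfold likelihood gaussianPDF
  rw [← ENNReal.ofReal_prod_of_nonneg fun i _ => gaussianPDFReal_nonneg _ _ _]
  congr 1
  simp only [gaussianPDFReal, hv, Finset.prod_mul_distrib, Finset.prod_const, Finset.card_univ,
    Fintype.card_fin, ← Real.exp_sum]
  rw [mul_assoc (_ ^ n), ← Real.exp_add]
  congr 2
  have hi : ∀ i, (X *ᵥ β₀ + e) i - (X *ᵥ β) i = e i - (X *ᵥ (β - β₀)) i := fun i => by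
    rw [Matrix.mulVec_sub, Pi.add_apply, Pi.sub_apply]; ring
  simp only [hi]
  rw [← Matrix.dotProduct_mulVec, ← Finset.sum_div]
  set u := X *ᵥ (β - β₀)
  have : ∑ i, -(e i - u i) ^ 2 = -(e ⬝ᵥ e) + 2 * (e ⬝ᵥ u) - u ⬝ᵥ u := by
    simp only [dotProduct, Finset.mul_sum, ← Finset.sum_neg_distrib, ← Finset.sum_add_distrib,
      ← Finset.sum_sub_distrib]
    exact Finset.sum_congr rfl fun i _ => by ring
  rw [this]
  field_simp
  ring

/-- In units of `n d ε² / (16 σ²)`, the numerator has exponent `-4`, the likelihood on `B` at least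
`-1`, and the prior mass of `B` at least `-1`; the quotient therefore has exponent `-2`. -/
theorem posterior_le {n p : ℕ} (hn : 0 < n) {X : Matrix (Fin n) (Fin p) ℝ} {σ : ℝ} (hσ : 0 < σ)
    {d D : ℝ} (hd0 : 0 < d) (hd : ∀ j, d ≤ gramEigenvalues X j)
    (hD0 : 0 ≤ D) (hD : ∀ j, gramEigenvalues X j ≤ D)
    {ε η r : ℝ} (hε : 0 < ε) (hη0 : 0 ≤ η) (hη : η ≤ d * ε / 4)
    (hr : η * r + D * r ^ 2 / 2 ≤ d * ε ^ 2 / 16)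
    {μ : Measure (Fin p → ℝ)} (hμ : μ Set.univ ≤ 1) {β₀ : Fin p → ℝ} {B : Set (Fin p → ℝ)}
    (hB : MeasurableSet B) (hBr : ∀ β ∈ B, ‖WithLp.toLp 2 (β - β₀)‖ ≤ r)
    (hBμ : ENNReal.ofReal (Real.exp (-(n * (d * ε ^ 2 / (16 * σ ^ 2))))) ≤ μ B)
    {e : Fin n → ℝ} (he : ‖WithLp.toLp 2 (e ᵥ* X)‖ ≤ η * n) :
    posterior μ X σ (X *ᵥ β₀ + e) {β | ε < ‖WithLp.toLp 2 (β - β₀)‖} ≤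
      ENNReal.ofReal (Real.exp (-(n * (d * ε ^ 2 / (8 * σ ^ 2))))) := by
  obtain ⟨L, hL, hlik⟩ := likelihood_eq X hσ β₀ e
  have hn' : (0 : ℝ) < n := by exact_mod_cast hn
  set A : Set (Fin p → ℝ) := {β | ε < ‖WithLp.toLp 2 (β - β₀)‖}
  have hA : MeasurableSet A := by
    have : Continuous fun β : Fin p → ℝ => ‖WithLp.toLp 2 (β - β₀)‖ :=
      ((PiLp.continuous_toLp 2 _).comp (continuous_id.sub continuous_const)).norm
    exact (isOpen_lt continuous_const this).measurableSet
  have hcross : ∀ h : Fin p → ℝ, |(e ᵥ* X) ⬝ᵥ h| ≤ η * n * ‖WithLp.toLp 2 h‖ := fun h =>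
    (abs_dotProduct_le _ _).trans (by gcongr)
  have hup : ∀ β ∈ A, likelihood X σ (X *ᵥ β₀ + e) β ≤
      ENNReal.ofReal (L * Real.exp (-(n * (d * ε ^ 2 / 4)) / σ ^ 2)) := by
    intro β hβ
    rw [hlik]
    refine ENNReal.ofReal_le_ofReal ?_
    have h1 := (abs_le.1 (hcross (β - β₀))).2
    have h2 := mulVec_dotProduct_self_ge hn hd (β - β₀)
    rw [← norm_toLp_sq] at h2
    have h3 : ε < ‖WithLp.toLp 2 (β - β₀)‖ := hβ
    set s := ‖WithLp.toLp 2 (β - β₀)‖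
    have hs : 0 < s := hε.trans h3
    gcongr
    -- As `s > ε` and `η ≤ d ε / 4`, the noise term uses up at most half of the quadratic term `n d
    -- s² / 2`.
    have h4 : η * n * s ≤ n * d * s ^ 2 / 4 := by
      have : η * s ≤ d * s ^ 2 / 4 := by nlinarith [mul_le_mul_of_nonneg_left h3.le hd0.le]
      nlinarith
    have h5 : n * (d * ε ^ 2 / 4) ≤ n * d * s ^ 2 / 4 := by
      have : ε ^ 2 ≤ s ^ 2 := by gcongr
      have : d * ε ^ 2 ≤ d * s ^ 2 := by gcongr
      nlinarith
    linarith
  have hlow : ∀ β ∈ B, ENNReal.ofReal (L * Real.exp (-(n * (d * ε ^ 2 / 16)) / σ ^ 2)) ≤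
      likelihood X σ (X *ᵥ β₀ + e) β := by
    intro β hβ
    rw [hlik]
    refine ENNReal.ofReal_le_ofReal ?_
    have h1 := (abs_le.1 (hcross (β - β₀))).1
    have h2 := mulVec_dotProduct_self_le hn hD (β - β₀)
    rw [← norm_toLp_sq (β - β₀)] at h2
    have h3 := hBr β hβ
    set s := ‖WithLp.toLp 2 (β - β₀)‖
    have hs : 0 ≤ s := norm_nonneg _
    gcongr
    have h4 : η * s + D * s ^ 2 / 2 ≤ d * ε ^ 2 / 16 := le_trans (by gcongr) hr
    have h5 := mul_le_mul_of_nonneg_left h4 hn'.le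
    linarith
  rw [posterior, Measure.smul_apply, smul_eq_mul, withDensity_apply _ hA]
  have hnum : ∫⁻ β in A, likelihood X σ (X *ᵥ β₀ + e) β ∂μ ≤
      ENNReal.ofReal (L * Real.exp (-(n * (d * ε ^ 2 / 4)) / σ ^ 2)) := by
    refine (setLIntegral_mono' hA hup).trans ?_
    rw [setLIntegral_const]
    exact mul_le_of_le_one_right' ((measure_mono (Set.subset_univ _)).trans hμ)
  have hden : ENNReal.ofReal (L * Real.exp (-(n * (d * ε ^ 2 / 16)) / σ ^ 2) *
      Real.exp (-(n * (d * ε ^ 2 / (16 * σ ^ 2))))) ≤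
      ∫⁻ β, likelihood X σ (X *ᵥ β₀ + e) β ∂μ := by
    rw [ENNReal.ofReal_mul (by positivity)]
    refine (mul_le_mul_right hBμ _).trans ?_
    rw [← setLIntegral_const]
    exact (setLIntegral_mono' hB hlow).trans (setLIntegral_le_lintegral _ _)
  refine (mul_le_mul' (ENNReal.inv_le_inv.2 hden) hnum).trans ?_
  rw [← ENNReal.ofReal_inv_of_pos (by positivity), ← ENNReal.ofReal_mul (by positivity)]
  refine ENNReal.ofReal_le_ofReal (le_of_eq ?_)
  rw [mul_inv, mul_inv, ← Real.exp_neg, ← Real.exp_neg]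
  have : ∀ x y z : ℝ, L⁻¹ * Real.exp x * Real.exp y * (L * Real.exp z) = Real.exp (x + y + z) := by
    intro x y z
    rw [Real.exp_add, Real.exp_add]
    field_simp
  rw [this]
  congr 1
  field_simp
  ring

/-! ### The errors -/

/-- By independence, each coordinate of `Xᵀe` has variance `σ²` times the squared norm of a column
of `X`. That squared norm is the quadratic form of `XᵀX` at a basis vector, hence at most `n D`. -/
theorem integral_norm_vecMul_sq_le {n p : ℕ} (hn : 0 < n) {X : Matrix (Fin n) (Fin p) ℝ}
    {D : ℝ} (hD : ∀ j, gramEigenvalues X j ≤ D) {Ω : Type*} [MeasurableSpace Ω]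
    {P : Measure Ω} [IsProbabilityMeasure P] {err : Fin n → Ω → ℝ} {σ : ℝ}
    (hindep : iIndepFun err P) (hmemLp : ∀ i, MemLp (err i) 2 P)
    (hmean : ∀ i, ∫ ω, err i ω ∂P = 0) (hvar : ∀ i, variance (err i) P = σ ^ 2) :
    Integrable (fun ω => ‖WithLp.toLp 2 ((fun i => err i ω) ᵥ* X)‖ ^ 2) P ∧
    ∫ ω, ‖WithLp.toLp 2 ((fun i => err i ω) ᵥ* X)‖ ^ 2 ∂P ≤ σ ^ 2 * (n * D) * p := by
  have hcol : ∀ j, ∑ i, X i j ^ 2 ≤ n * D := fun j => by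
    have := mulVec_dotProduct_self_le hn hD (Pi.single j 1)
    have h1 : (Pi.single j 1 : Fin p → ℝ) ⬝ᵥ Pi.single j 1 = 1 := by simp
    rw [h1, mul_one] at this
    simpa [dotProduct, Matrix.mulVec_single_one, Matrix.col_apply, sq] using this
  have hL : ∀ i j, MemLp (fun ω => X i j * err i ω) 2 P := fun i j => (hmemLp i).const_mul _
  have hS : ∀ j, MemLp (fun ω => ∑ i, X i j * err i ω) 2 P := fun j =>
    memLp_finsetSum _ fun i _ => hL i j
  have hS0 : ∀ j, ∫ ω, ∑ i, X i j * err i ω ∂P = 0 := fun j => by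
    rw [integral_finsetSum _ fun i _ => (hL i j).integrable (by norm_num)]
    simp [integral_const_mul, hmean]
  have hSv : ∀ j, ∫ ω, (∑ i, X i j * err i ω) ^ 2 ∂P ≤ σ ^ 2 * (n * D) := fun j => by
    rw [← variance_of_integral_eq_zero (hS j).aemeasurable (hS0 j)]
    have h1 : (fun ω => ∑ i, X i j * err i ω) = ∑ i, fun ω => X i j * err i ω := by
      ext ω; simp
    rw [h1, IndepFun.variance_sum (fun i _ => hL i j) fun i _ k _ hik =>
      (hindep.indepFun hik).comp (measurable_const_mul (X i j)) (measurable_const_mul (X k j))]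
    simp only [variance_const_mul, hvar, ← Finset.sum_mul]
    rw [mul_comm]
    exact mul_le_mul_of_nonneg_left (hcol j) (sq_nonneg σ)
  have hnorm : ∀ ω, ‖WithLp.toLp 2 ((fun i => err i ω) ᵥ* X)‖ ^ 2 =
      ∑ j, (∑ i, X i j * err i ω) ^ 2 := fun ω => by
    rw [EuclideanSpace.real_norm_sq_eq]
    simp [Matrix.vecMul, dotProduct, mul_comm]
  simp only [hnorm]
  refine ⟨integrable_finsetSum _ fun j _ => (hS j).integrable_sq, ?_⟩
  rw [integral_finsetSum _ fun j _ => (hS j).integrable_sq]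
  refine (Finset.sum_le_sum fun j _ => hSv j).trans (le_of_eq ?_)
  simp [mul_comm]

theorem measure_norm_vecMul_gt_le {n p : ℕ} (hn : 0 < n) {X : Matrix (Fin n) (Fin p) ℝ}
    {D : ℝ} (hD : ∀ j, gramEigenvalues X j ≤ D) {Ω : Type*} [MeasurableSpace Ω]
    {P : Measure Ω} [IsProbabilityMeasure P] {err : Fin n → Ω → ℝ} {σ : ℝ}
    (hindep : iIndepFun err P) (hmemLp : ∀ i, MemLp (err i) 2 P)
    (hmean : ∀ i, ∫ ω, err i ω ∂P = 0) (hvar : ∀ i, variance (err i) P = σ ^ 2)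
    {η : ℝ} (hη : 0 < η) :
    P {ω | η * n < ‖WithLp.toLp 2 ((fun i => err i ω) ᵥ* X)‖} ≤
      ENNReal.ofReal (σ ^ 2 * D / η ^ 2 * (p / n)) := by
  obtain ⟨h1, h2⟩ := integral_norm_vecMul_sq_le hn hD hindep hmemLp hmean hvar
  have hn' : (0 : ℝ) < n := by exact_mod_cast hn
  have h3 := mul_meas_ge_le_integral_of_nonneg
    (Eventually.of_forall fun ω => by positivity) h1 ((η * n) ^ 2)
  have hsub : {ω | η * n < ‖WithLp.toLp 2 ((fun i => err i ω) ᵥ* X)‖} ⊆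
      {ω | (η * n) ^ 2 ≤ ‖WithLp.toLp 2 ((fun i => err i ω) ᵥ* X)‖ ^ 2} := fun ω hω => by
    have : η * n < ‖WithLp.toLp 2 ((fun i => err i ω) ᵥ* X)‖ := hω
    exact pow_le_pow_left₀ (by positivity) this.le 2
  refine (measure_mono hsub).trans ?_
  rw [← ofReal_measureReal]
  refine ENNReal.ofReal_le_ofReal ?_
  have h4 : σ ^ 2 * D / η ^ 2 * (p / n) = σ ^ 2 * (n * D) * p / (η * n) ^ 2 := by
    field_simp
  rw [h4, le_div_iff₀ (by positivity), mul_comm]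
  exact h3.trans h2

/-! ### Asymptotics of the prior -/

theorem measurableSet_box {p : ℕ} (β₀ : Fin p → ℝ) (t : ℝ) :
    MeasurableSet {β : Fin p → ℝ | ∀ j, |β j - β₀ j| ≤ t} := by
  rw [Set.ofPred_forall]
  refine MeasurableSet.iInter fun j => measurableSet_le ?_ measurable_const
  exact ((measurable_pi_apply j).sub_const _).abs

theorem norm_sub_le_of_mem_box {p : ℕ} (hp : 0 < p) {β₀ β : Fin p → ℝ} {r : ℝ} (hr : 0 ≤ r)
    (h : ∀ j, |β j - β₀ j| ≤ r / √p) : ‖WithLp.toLp 2 (β - β₀)‖ ≤ r := by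
  have hp' : (0 : ℝ) < p := by exact_mod_cast hp
  refine abs_le_of_sq_le_sq' ?_ hr |>.2
  rw [EuclideanSpace.real_norm_sq_eq]
  calc
    _ ≤ ∑ _j : Fin p, r ^ 2 / p := Finset.sum_le_sum fun j _ => by
      have := pow_le_pow_left₀ (abs_nonneg _) (h j) 2
      rw [sq_abs, div_pow, Real.sq_sqrt hp'.le] at this
      exact this
    _ = r ^ 2 := by
      rw [Finset.sum_const, Finset.card_univ, Fintype.card_fin, nsmul_eq_mul]
      field_simp

theorem eventually_dlPrior_box_ge {p : ℕ → ℕ} (hp : ∀ n, 0 < p n) {β₀ : ∀ n, Fin (p n) → ℝ}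
    {σ : ℝ} (hσ : 0 < σ) {M : ℝ} (hM : ∀ᶠ n in atTop, ∀ j, |β₀ n j| ≤ M)
    (hp_growth : (fun n => (p n : ℝ)) =o[atTop] fun n : ℕ => (n : ℝ))
    (hq_growth : (fun n => (({j | β₀ n j ≠ 0} : Set (Fin (p n))).ncard : ℝ)) =o[atTop]
      fun n : ℕ => (n : ℝ) / Real.log n)
    {ρ C : ℝ} (hρ : 0 < ρ) (hC : 0 < C) {a : ℕ → ℝ}
    (ha : ∀ᶠ n : ℕ in atTop, a n = C / (p n * (n : ℝ) ^ ρ * Real.log n))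
    {r c : ℝ} (hr : 0 < r) (hr1 : r ≤ 1) (hc : 0 < c) :
    ∀ᶠ n : ℕ in atTop, 0 < a n ∧ a n < 1 ∧ ENNReal.ofReal (Real.exp (-(n * c))) ≤
      dlPrior (p n) (a n) σ {β | ∀ j, |β j - β₀ n j| ≤ r / √(p n)} := by
  have hκ := slabConst_pos M hσ
  have hlog : Tendsto (fun n : ℕ => Real.log n) atTop atTop :=
    Real.tendsto_log_atTop.comp tendsto_natCast_atTop_atTop
  have hpow : Tendsto (fun n : ℕ => (n : ℝ) ^ ρ) atTop atTop :=
    (tendsto_rpow_atTop hρ).comp tendsto_natCast_atTop_atTop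
  have hgrow : Tendsto (fun n : ℕ => (n : ℝ) ^ ρ * Real.log n) atTop atTop :=
    hpow.atTop_mul_atTop₀ hlog
  have hcast : Tendsto (fun n : ℕ => (n : ℝ)) atTop atTop := tendsto_natCast_atTop_atTop
  filter_upwards [ha, hM, hgrow.eventually_gt_atTop C,
    hgrow.eventually_ge_atTop (4 * C * σ / r), hlog.eventually_gt_atTop 0,
    eventually_gt_atTop 1, hcast.eventually_ge_atTop (1 / (slabConst σ M * C * r)),
    -- The budget `c n` is split in two halves: `2p ≤ c n / 2` for the factors `exp (-2)` and `(ρ +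
    -- 5) q log n ≤ c n / 2` for the nonzero coordinates.
    hp_growth.bound (show 0 < min 1 (c / 4) by positivity),
    hq_growth.bound (show 0 < c / 2 / (ρ + 5) by positivity)]
    with n ha hM hg1 hg2 hl hn hbig hpn hqn
  have hn0 : (0 : ℝ) < n := by exact_mod_cast (zero_lt_one.trans hn)
  have hn1 : (1 : ℝ) ≤ n := by exact_mod_cast hn.le
  have hp0 : (0 : ℝ) < p n := by exact_mod_cast hp n
  have hp1 : (1 : ℝ) ≤ p n := by exact_mod_cast hp n
  set g := (n : ℝ) ^ ρ * Real.log n with hgdef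
  have hg0 : 0 < g := by positivity
  have hag : a n = C / g / p n := by rw [ha, hgdef]; field_simp
  have ha0 : 0 < a n := by rw [hag]; positivity
  have ha1 : a n < 1 := by
    rw [hag, div_lt_one hp0]
    exact lt_of_lt_of_le ((div_lt_one hg0).2 hg1) hp1
  have hs0 : 0 < √(p n : ℝ) := Real.sqrt_pos.2 hp0
  have hs1 : 1 ≤ √(p n : ℝ) := Real.one_le_sqrt.2 hp1
  have hsp : √(p n : ℝ) * √(p n : ℝ) = p n := Real.mul_self_sqrt hp0.le
  have hsp' : √(p n : ℝ) ≤ p n := by nlinarith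
  have ht1 : r / √(p n : ℝ) ≤ 1 := by rw [div_le_one hs0]; linarith
  have ht : 4 * a n * σ ≤ r / √(p n : ℝ) := by
    rw [div_le_iff₀ hr] at hg2
    rw [hag, le_div_iff₀ hs0]
    calc 4 * (C / g / p n) * σ * √(p n : ℝ) = 4 * C * σ / g * (√(p n : ℝ) / p n) := by
          field_simp
      _ ≤ 4 * C * σ / g * 1 := by
          gcongr
          rwa [div_le_one hp0]
      _ ≤ r := by rw [mul_one, div_le_iff₀ hg0]; linarith
  refine ⟨ha0, ha1, le_trans (ENNReal.ofReal_le_ofReal ?_)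
    (dlPrior_box_ge (hp n) ha0 ha1 hσ ht ht1 hM)⟩
  set q := ({j | β₀ n j ≠ 0} : Set (Fin (p n))).ncard
  rw [Real.norm_of_nonneg hp0.le, Real.norm_of_nonneg hn0.le] at hpn
  have hpn1 : (p n : ℝ) ≤ n := hpn.trans (by nlinarith [min_le_left 1 (c / 4)])
  have hpn2 : 2 * (p n : ℝ) ≤ c / 2 * n := by nlinarith [min_le_right 1 (c / 4)]
  have hqn' : (ρ + 5) * (q * Real.log n) ≤ c / 2 * n := by
    rw [Real.norm_of_nonneg (by positivity), Real.norm_of_nonneg (by positivity),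
      ← mul_div_assoc, le_div_iff₀ hl] at hqn
    calc (ρ + 5) * (q * Real.log n) ≤ (ρ + 5) * (c / 2 / (ρ + 5) * n) := by gcongr
      _ = c / 2 * n := by field_simp
  -- Each of `log n`, `p` and `√p` is at most `n`, giving `n ^ (ρ + 3)` in the denominator; one more
  -- power of `n` absorbs the constant, and the fifth is slack.
  have hlow : Real.exp (-((ρ + 5) * Real.log n)) ≤ slabConst σ M * a n * (r / √(p n : ℝ)) := by
    have e1 : Real.exp (-((ρ + 5) * Real.log n)) = 1 / ((n : ℝ) ^ ρ * (n : ℝ) ^ 5) := by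
      rw [Real.exp_neg, mul_comm, Real.exp_mul, Real.exp_log hn0, Real.rpow_add hn0, one_div]
      norm_cast
    have e2 : slabConst σ M * a n * (r / √(p n : ℝ)) =
        (slabConst σ M * C * r) / (g * p n * √(p n : ℝ)) := by rw [hag]; field_simp
    rw [e1, e2, div_le_div_iff₀ (by positivity) (by positivity), one_mul, hgdef]
    have hln : Real.log n ≤ n := (Real.log_le_sub_one_of_pos hn0).trans (by linarith)
    rw [div_le_iff₀ (by positivity)] at hbig
    calc (n : ℝ) ^ ρ * Real.log n * p n * √(p n : ℝ) ≤ (n : ℝ) ^ ρ * n * n * n := by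
          gcongr
          exact hsp'.trans hpn1
      _ = 1 * ((n : ℝ) ^ ρ * n ^ 3) := by ring
      _ ≤ (n * (slabConst σ M * C * r)) * ((n : ℝ) ^ ρ * n ^ 4) := by
          gcongr
          norm_num
      _ = slabConst σ M * C * r * ((n : ℝ) ^ ρ * n ^ 5) := by ring
  calc Real.exp (-(n * c)) ≤ Real.exp (-(2 * (p n : ℝ)) - (ρ + 5) * (q * Real.log n)) := by
        rw [Real.exp_le_exp]; linarith
    _ = Real.exp (-2) ^ p n * Real.exp (-((ρ + 5) * Real.log n)) ^ q := by
        rw [← Real.exp_nat_mul, ← Real.exp_nat_mul, ← Real.exp_add]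
        congr 1
        ring
    _ ≤ _ := by gcongr

/-! ### Bounds extracted from limits in the extended reals -/

theorem eventually_forall_ge_of_lt_liminf {p : ℕ → ℕ} {u : ∀ n, Fin (p n) → ℝ} {d : ℝ}
    (h : (d : EReal) < liminf (fun n => ⨅ j, ((u n j : ℝ) : EReal)) atTop) :
    ∀ᶠ n in atTop, ∀ j, d ≤ u n j := by
  filter_upwards [eventually_lt_of_lt_liminf h] with n hn j
  exact EReal.coe_le_coe_iff.1 (hn.le.trans (iInf_le _ j))

theorem eventually_forall_le_of_limsup_lt {p : ℕ → ℕ} {u : ∀ n, Fin (p n) → ℝ} {d : ℝ}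
    (h : limsup (fun n => ⨆ j, ((u n j : ℝ) : EReal)) atTop < (d : EReal)) :
    ∀ᶠ n in atTop, ∀ j, u n j ≤ d := by
  filter_upwards [eventually_lt_of_limsup_lt h] with n hn j
  exact EReal.coe_le_coe_iff.1 ((le_iSup (fun j => ((u n j : ℝ) : EReal)) j).trans hn.le)

end DLRegression

open DLRegression in
theorem theorem2
    -- dimensions, designs and true coefficients
    (p : ℕ → ℕ) (hp : ∀ n, 0 < p n)
    (X : ∀ n, Matrix (Fin n) (Fin (p n)) ℝ) (β₀ : ∀ n, Fin (p n) → ℝ)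
    -- (A1) i.i.d. errors with mean zero and finite variance `σ ^ 2`
    (σ : ℝ) (hσ : 0 < σ)
    {Ω : ℕ → Type*} [∀ n, MeasurableSpace (Ω n)]
    (P : ∀ n, Measure (Ω n)) [∀ n, IsProbabilityMeasure (P n)]
    (err : ∀ n, Fin n → Ω n → ℝ)
    (herr_indep : ∀ n, iIndepFun (err n) (P n))
    (herr_ident : ∀ n i j, IdentDistrib (err n i) (err n j) (P n) (P n))
    (herr_memLp : ∀ n i, MemLp (err n i) 2 (P n))
    (herr_mean : ∀ n i, ∫ ω, err n i ω ∂(P n) = 0)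
    (herr_var : ∀ n i, variance (err n i) (P n) = σ ^ 2)
    -- (A2) the eigenvalues of `Xᵀ X / n` are bounded away from `0` and `∞`
    (dmin dmax : ℝ) (hdmin : 0 < dmin)
    (hA2_lower : (dmin : EReal) <
      liminf (fun n => ⨅ j, ((gramEigenvalues (X n) j : ℝ) : EReal)) atTop)
    (hA2_upper : limsup (fun n => ⨆ j, ((gramEigenvalues (X n) j : ℝ) : EReal)) atTop <
      (dmax : EReal))
    -- (A3) the true coefficients are bounded
    (hA3 : limsup (fun n => ⨆ j, ((|β₀ n j| : ℝ) : EReal)) atTop < ⊤)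
    -- growth of the dimension and of the number of nonzero true coefficients
    (hp_growth : (fun n => (p n : ℝ)) =o[atTop] fun n : ℕ => (n : ℝ))
    (hq_growth : (fun n => (({j | β₀ n j ≠ 0} : Set (Fin (p n))).ncard : ℝ)) =o[atTop]
      fun n : ℕ => (n : ℝ) / Real.log n)
    -- Dirichlet concentration
    (ρ C : ℝ) (hρ : 0 < ρ) (hC : 0 < C) (a : ℕ → ℝ)
    (ha : ∀ᶠ n : ℕ in atTop, a n = C / (p n * (n : ℝ) ^ ρ * Real.log n)) :
    -- the posterior mass outside every ball around the truth tends to `0` in probability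
    ∀ ε : ℝ, 0 < ε → ∀ δ : ℝ≥0∞, 0 < δ →
      Tendsto
        (fun n => P n {ω | δ ≤
          posterior (dlPrior (p n) (a n) σ) (X n) σ (X n *ᵥ β₀ n + fun i => err n i ω)
            {β | ε < ‖WithLp.toLp 2 (β - β₀ n)‖}})
        atTop (𝓝 0) := by
  intro ε hε δ hδ
  have hlow := eventually_forall_ge_of_lt_liminf hA2_lower
  have hup := eventually_forall_le_of_limsup_lt hA2_upper
  obtain ⟨M, hM, -⟩ := EReal.lt_iff_exists_real_btwn.1 hA3
  have hβ := eventually_forall_le_of_limsup_lt hM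
  -- Enlarging `dmax` to a positive `D` avoids deriving its sign.
  obtain ⟨D, hD, hD0⟩ : ∃ D : ℝ, dmax ≤ D ∧ 0 < D :=
    ⟨max dmax 1, le_max_left _ _, lt_max_of_lt_right one_pos⟩
  set κ := dmin * ε ^ 2 / 16
  have hκ : 0 < κ := by positivity
  set η := dmin * ε / 4
  have hη : 0 < η := by positivity
  obtain ⟨r, hr, hr1, hrκ⟩ : ∃ r : ℝ, 0 < r ∧ r ≤ 1 ∧ η * r + D * r ^ 2 / 2 ≤ κ := by
    -- Since `r ≤ 1` gives `r² ≤ r`, the sum is at most `r (η + D) ≤ κ`.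
    refine ⟨min 1 (κ / (η + D)), by positivity, min_le_left _ _, ?_⟩
    set r := min 1 (κ / (η + D))
    have h0 : 0 < r := by positivity
    have h1 : r ≤ 1 := min_le_left _ _
    have h2 : r * (η + D) ≤ κ := (le_div_iff₀ (by positivity)).1 (min_le_right _ _)
    nlinarith [mul_le_mul_of_nonneg_left h1 (mul_pos hD0 h0).le, mul_pos hD0 h0]
  have hprior := eventually_dlPrior_box_ge hp hσ hβ hp_growth hq_growth hρ hC ha hr hr1
    (show 0 < dmin * ε ^ 2 / (16 * σ ^ 2) by positivity)
  have hsmall : ∀ᶠ n : ℕ in atTop,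
      ENNReal.ofReal (Real.exp (-(n * (dmin * ε ^ 2 / (8 * σ ^ 2))))) < δ := by
    have h1 : Tendsto (fun n : ℕ => (n : ℝ) * (dmin * ε ^ 2 / (8 * σ ^ 2))) atTop atTop :=
      tendsto_natCast_atTop_atTop.atTop_mul_const (by positivity)
    have h2 := ENNReal.tendsto_ofReal (Real.tendsto_exp_neg_atTop_nhds_zero.comp h1)
    rw [ENNReal.ofReal_zero] at h2
    exact h2.eventually_lt_const hδ
  have hlim : Tendsto (fun n : ℕ => ENNReal.ofReal (σ ^ 2 * D / η ^ 2 * ((p n : ℝ) / n)))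
      atTop (𝓝 0) := by
    have := ENNReal.tendsto_ofReal
      ((hp_growth.tendsto_div_nhds_zero).const_mul (σ ^ 2 * D / η ^ 2))
    simpa using this
  refine tendsto_of_tendsto_of_tendsto_of_le_of_le' tendsto_const_nhds hlim
    (Eventually.of_forall fun _ => zero_le) ?_
  filter_upwards [hlow, hup, hprior, hsmall, eventually_gt_atTop 0]
    with n hlow hup ⟨ha0, ha1, hbox⟩ hsmall hn
  have hup' : ∀ j, gramEigenvalues (X n) j ≤ D := fun j => (hup j).trans hD
  -- The bad event is contained in the event that `‖Xᵀe‖` is large. Monotonicity of the outer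
  -- measure suffices, so the posterior need not be shown measurable in `ω`.
  refine (measure_mono fun ω hω => ?_).trans
    (measure_norm_vecMul_gt_le hn hup' (herr_indep n) (herr_memLp n) (herr_mean n)
      (herr_var n) hη)
  by_contra hcon
  have hpost := posterior_le hn hσ hdmin hlow hD0.le hup' hε hη.le le_rfl hrκ
    (dlPrior_univ_le_one (hp n) ha0 ha1) (measurableSet_box (β₀ n) _)
    (fun β hβ => norm_sub_le_of_mem_box (hp n) hr.le hβ) hbox (not_lt.1 hcon)
  exact absurd (lt_of_le_of_lt hpost hsmall) (not_lt.2 hω)
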